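/- Let $d\in\{2,3\}$ and let $\Omega\subset\mathbb R^d$ be a bounded domain with $C^1$ boundary and surface measure $ds$. Let $\mathcal N_1(x,y)$ be the Neumann function of $\Omega$ with unit coefficient: for every $x\in\Omega$, $$-\Delta_y\mathcal N_1(x,y)=\delta(x-y)\ \text{ for } y\in\Omega,\qquad -\frac{\partial}{\partial n_y}\mathcal N_1(x,y)=\frac1{|\partial\Omega|}\ \text{ for } y\in\partial\Omega,\qquad \int_{\partial\Omega}\mathcal N_1(x,y)\,ds_y=0,$$ where $\mathcal N_1(x,\cdot)\in W^{1,1}(\Omega)$ is of class $C^1$ on $\overline\Omega\setminus\{x\}$ (up to the boundary), and where $\mathcal N_1$ is extended to $x\in\partial\Omega$ so as to be continuous on $\{(x,y)\in\overline\Omega\times\overline\Omega: x\ne y\}$. Let $p_{k^+},p_{k^-},p_{l^+},p_{l^-}\in\partial\Omega$ with $p_{l^\pm}\notin\{p_{k^+},p_{k^-}\}$, let $I\in\mathbb R$, and let $\gamma$ be a complex admittivity. Let $u_k\in W^{1,1}(\Omega)$ be complex valued, continuous on $\overline\Omega\setminus\{p_{k^+},p_{k^-}\}$, and a solution of the point electrode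 model $$\nabla\cdot(\gamma\nabla u_k)=0\ \text{ in }\Omega,\qquad \gamma\frac{\partial u_k}{\partial n}=I\,(\delta_{p_{k^+}}-\delta_{p_{k^-}})\ \text{ on }\partial\Omega,\qquad \int_{\partial\Omega}u_k\,ds=0,$$ and put $U_{k,l}:=u_k(p_{l^+})-u_k(p_{l^-})$. The equations with their boundary conditions, for $\mathcal N_1$ and for $u_k$, are understood in the weak sense: $$\int_\Omega\nabla_y\mathcal N_1(x,y)\cdot\nabla\varphi(y)\,dy=\varphi(x)-\frac1{|\partial\Omega|}\int_{\partial\Omega}\varphi\,ds,\qquad \int_\Omega\gamma\nabla u_k\cdot\nabla\varphi\,dy=I\,(\varphi(p_{k^+})-\varphi(p_{k^-}))$$ for all real $\varphi\in C^1(\overline\Omega)$, and the boundary values of $\mathcal N_1(x,\cdot)$ and of $u_k$ are their traces. If $\gamma$ is constant in $\Omega$ and $U_{k,l}\neq0$, then $$\gamma=\frac{I}{U_{k,l}}\Bigl(\mathcal N_1(p_{k^+},p_{l^+})-\mathcal N_1(p_{k^+},p_{l^-})-\mathcal N_1(p_{k^-},p_{l^+})+\mathcal N_1(p_{k^-},p_{l^-})\Bigr).$$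 -/

import Mathlib

open MeasureTheory Filter Topology Set

noncomputable section

namespace EIT

/-- Euclidean space of dimension `d`. -/
abbrev E (d : ℕ) : Type := EuclideanSpace ℝ (Fin d)

/-- A bounded domain (nonempty, open, connected) with `C¹` boundary: near each boundary point the
set is the strict sublevel set of a `C¹` function with nonvanishing derivative at that point. -/
structure IsC1Domain {d : ℕ} (Ω : Set (E d)) : Prop where
  isOpen : IsOpen Ω
  isConnected : IsConnected Ω
  isBounded : Bornology.IsBounded Ω
  exists_defining : ∀ p ∈ frontier Ω, ∃ V ∈ 𝓝 p, ∃ ρ : E d → ℝ,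
    ContDiff ℝ 1 ρ ∧ fderiv ℝ ρ p ≠ 0 ∧ ∀ x ∈ V, (x ∈ Ω ↔ ρ x < 0)

/-- The surface measure `ds` on `∂Ω`: the `(d - 1)`-dimensional Hausdorff measure, in the Euclidean
normalization, restricted to the boundary. -/
def surfaceMeasure {d : ℕ} (Ω : Set (E d)) : Measure (E d) :=
  (Measure.euclideanHausdorffMeasure (d - 1)).restrict (frontier Ω)

/-- `∇f · ∇φ`, in terms of the derivatives `A` of `f` and `B` of the real function `φ`. -/
def gradDot {d : ℕ} {F : Type*} [NormedAddCommGroup F] [NormedSpace ℝ F]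
    (A : E d →L[ℝ] F) (B : E d →L[ℝ] ℝ) : F :=
  ∑ i : Fin d, B (EuclideanSpace.single i 1) • A (EuclideanSpace.single i 1)

/-- `f` belongs to `C¹(closure Ω \ P)`: it is continuous there, differentiable in `Ω \ P`, and its
derivative extends continuously to `closure Ω \ P`. -/
def IsC1UpToBoundary {d : ℕ} {F : Type*} [NormedAddCommGroup F] [NormedSpace ℝ F]
    (Ω P : Set (E d)) (f : E d → F) : Prop :=
  ContinuousOn f (closure Ω \ P) ∧
    ∃ D : E d → E d →L[ℝ] F, ContinuousOn D (closure Ω \ P) ∧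
      ∀ y ∈ Ω \ P, HasFDerivAt f (D y) y

/-- `u` belongs to the Sobolev space `W^{1,1}(Ω)` with gradient `G`, and the restriction of `u` to
`∂Ω` is its trace in `L¹(∂Ω)`. The space is the completion of `C¹(closure Ω)`, and the trace
operator is the continuous extension of the restriction to the boundary. -/
structure HasW11Grad {d : ℕ} {F : Type*} [NormedAddCommGroup F] [NormedSpace ℝ F]
    (Ω : Set (E d)) (u : E d → F) (G : E d → E d →L[ℝ] F) : Prop where
  integrable : IntegrableOn u Ω
  integrable_grad : IntegrableOn G Ω
  integrable_trace : Integrable u (surfaceMeasure Ω)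
  exists_approx : ∃ φ : ℕ → E d → F, (∀ n, IsC1UpToBoundary Ω ∅ (φ n)) ∧
    Tendsto (fun n => eLpNorm (fun y => φ n y - u y) 1 (volume.restrict Ω)) atTop (𝓝 0) ∧
    Tendsto (fun n => eLpNorm (fun y => fderiv ℝ (φ n) y - G y) 1 (volume.restrict Ω))
      atTop (𝓝 0) ∧
    Tendsto (fun n => eLpNorm (fun y => φ n y - u y) 1 (surfaceMeasure Ω)) atTop (𝓝 0)

/-- `u` solves the point electrode model with admittivity `γ`, injected current `I` and injection
electrodes at `pp` (source) and `pm` (sink):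
`∇ · (γ ∇u) = 0` in `Ω`, `γ ∂u/∂n = I (δ_pp - δ_pm)` on `∂Ω`, `∫_{∂Ω} u ds = 0`.
The first two equations are in weak form, with test functions in `C¹(closure Ω)`. Off the injection
points `u` is continuous up to the boundary, so that it has point values there. -/
structure IsPointElectrodeSolution {d : ℕ} (Ω : Set (E d)) (γ : E d → ℂ) (I : ℝ) (pp pm : E d)
    (u : E d → ℂ) : Prop where
  continuousOn : ContinuousOn u (closure Ω \ {pp, pm})
  weak_form : ∃ G : E d → E d →L[ℝ] ℂ, HasW11Grad Ω u G ∧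
    IntegrableOn (fun y => γ y • G y) Ω ∧
    ∀ φ : E d → ℝ, IsC1UpToBoundary Ω ∅ φ →
      ∫ y in Ω, γ y * gradDot (G y) (fderiv ℝ φ y) = (I : ℂ) * ((φ pp : ℂ) - (φ pm : ℂ))
  integral_boundary : ∫ y, u y ∂(surfaceMeasure Ω) = 0

/-- The voltage difference between the points `qp` and `qm`. -/
def voltage {d : ℕ} (u : E d → ℂ) (qp qm : E d) : ℂ := u qp - u qm

/-- `N` is the Neumann function of `Ω` with unit coefficient: for each `x ∈ Ω`,
`-Δ_y N(x, ·) = δ_x` in `Ω`, `-∂N(x, ·)/∂n_y = 1 / |∂Ω|` on `∂Ω`, `∫_{∂Ω} N(x, y) ds_y = 0`.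
The first two equations are in weak form, `N(x, ·)` being integrable with integrable gradient and
of class `C¹` up to the boundary off the pole `x`.
The values for `x ∈ ∂Ω` are those of the continuous extension off the diagonal. -/
structure IsNeumannFunction {d : ℕ} (Ω : Set (E d)) (N : E d → E d → ℝ) : Prop where
  continuousOn : ContinuousOn (fun q : E d × E d => N q.1 q.2)
    {q | q.1 ∈ closure Ω ∧ q.2 ∈ closure Ω ∧ q.1 ≠ q.2}
  isC1 : ∀ x ∈ Ω, IsC1UpToBoundary Ω {x} (N x)
  hasW11Grad : ∀ x ∈ Ω, HasW11Grad Ω (N x) (fderiv ℝ (N x))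
  weak_form : ∀ x ∈ Ω, ∀ φ : E d → ℝ, IsC1UpToBoundary Ω ∅ φ →
    ∫ y in Ω, gradDot (fderiv ℝ (N x) y) (fderiv ℝ φ y) =
      φ x - 1 / (surfaceMeasure Ω).real univ * ∫ y, φ y ∂(surfaceMeasure Ω)
  integral_boundary : ∀ x ∈ Ω, ∫ y, N x y ∂(surfaceMeasure Ω) = 0

end EIT

end

/-!
Formally, Green's second identity applied to `N x` and to a field `u` with sources `∑ aᵢ δ_{pᵢ}`,
constant Neumann datum and zero mean over `∂Ω` gives `u x = ∑ N(x, pᵢ) aᵢ`. Both functions are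
singular, so neither is an admissible test function for the other. Testing the equation of `u` with
the cut off function `(1 - χ) N x` instead, where `χ = 1` near `x`, produces the right side, and its
left side is the integral of `u Δ(χ N x)`, the Laplacian being taken without its mass at `x`; this
integral equals `u x` since `u` is harmonic near `x`.

The representation formula for `u = N z` yields the symmetry of `N`, and for `u = γ₀ u_k` it yields
the values of the electrode solution in `Ω`. Both extend to the boundary by continuity.
-/

open scoped ContDiff Convolution Gradient

namespace EIT

section VectorCalculus

variable {H : Type*} [NormedAddCommGroup H] [InnerProductSpace ℝ H]

/-- The divergence of a vector field, as the trace of its derivative; the Laplacian of `f` appears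
below as `divergence (∇ f)`. -/
noncomputable def divergence (V : H → H) (y : H) : ℝ := LinearMap.trace ℝ H (fderiv ℝ V y)

lemma tsupport_divergence_subset (V : H → H) : tsupport (divergence V) ⊆ tsupport V :=
  closure_minimal (fun y hy => by
    contrapose! hy
    simp [divergence, image_eq_zero_of_notMem_tsupport fun h => hy (tsupport_fderiv_subset ℝ h)])
    (isClosed_tsupport V)

lemma hasCompactSupport_divergence {V : H → H} (hV : HasCompactSupport V) :
    HasCompactSupport (divergence V) :=
  hV.of_isClosed_subset (isClosed_tsupport _) (tsupport_divergence_subset V)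

lemma fderiv_comp_const_sub {F : Type*} [NormedAddCommGroup F] [NormedSpace ℝ F] (f : H → F)
    (a y : H) : fderiv ℝ (fun z => f (a - z)) y = -fderiv ℝ f (a - y) := by
  have hneg := (ContinuousLinearEquiv.neg ℝ (M := H)).comp_right_fderiv (f := f) (x := y - a)
  have hsub := fderiv_comp_sub (𝕜 := ℝ) (f := fun z => f (-z)) (x := y) a
  simp only [neg_sub] at hsub
  rw [hsub]
  ext v
  simpa [Function.comp_def] using DFunLike.congr_fun hneg v

variable [FiniteDimensional ℝ H]

lemma divergence_smul {f : H → ℝ} {V : H → H} {y : H} (hf : DifferentiableAt ℝ f y)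
    (hV : DifferentiableAt ℝ V y) :
    divergence (fun z => f z • V z) y = f y * divergence V y + fderiv ℝ f y (V y) := by
  rw [divergence, fderiv_fun_smul hf hV, ContinuousLinearMap.toLinearMap_add, map_add,
    ContinuousLinearMap.toLinearMap_smul, map_smul, ContinuousLinearMap.coe_smulRight,
    LinearMap.trace_smulRight]
  rfl

variable (H) in
/-- The trace of a continuous linear endomorphism, as a continuous linear functional. -/
noncomputable def traceL : (H →L[ℝ] H) →L[ℝ] ℝ :=
  LinearMap.toContinuousLinearMap (LinearMap.trace ℝ H ∘ₗ ContinuousLinearMap.coeLM ℝ)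

lemma continuous_divergence {V : H → H} (hV : ContDiff ℝ 1 V) : Continuous (divergence V) :=
  (traceL H).continuous.comp (hV.continuous_fderiv one_ne_zero)

lemma contDiff_gradient {m n : ℕ∞ω} {f : H → ℝ} (hf : ContDiff ℝ n f) (hmn : m + 1 ≤ n) :
    ContDiff ℝ m (∇ f) :=
  (InnerProductSpace.toDual ℝ H).symm.contDiff.comp (hf.fderiv_right hmn)

lemma tsupport_gradient_subset (f : H → ℝ) : tsupport (∇ f) ⊆ tsupport f :=
  closure_minimal (fun y hy => by
    contrapose! hy
    simp [gradient, image_eq_zero_of_notMem_tsupport fun h => hy (tsupport_fderiv_subset ℝ h)])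
    (isClosed_tsupport f)

lemma hasCompactSupport_gradient {f : H → ℝ} (hf : HasCompactSupport f) :
    HasCompactSupport (∇ f) :=
  hf.of_isClosed_subset (isClosed_tsupport _) (tsupport_gradient_subset f)

lemma fderiv_gradient_comm (f g : H → ℝ) (y : H) :
    fderiv ℝ f y (∇ g y) = fderiv ℝ g y (∇ f y) := by
  rw [← inner_gradient_left, real_inner_comm, inner_gradient_left]

lemma gradient_mul {f g : H → ℝ} {y : H} (hf : DifferentiableAt ℝ f y)
    (hg : DifferentiableAt ℝ g y) :
    ∇ (fun z => f z * g z) y = f y • ∇ g y + g y • ∇ f y := by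
  simp [gradient, fderiv_fun_mul hf hg]

lemma divergence_gradient_comp_const_sub (f : H → ℝ) (a y : H) :
    divergence (∇ fun z => f (a - z)) y = divergence (∇ f) (a - y) := by
  have hgrad : (∇ fun z => f (a - z)) = fun z => -∇ f (a - z) :=
    funext fun z => by simp [gradient, fderiv_comp_const_sub]
  rw [hgrad, divergence, fderiv_fun_neg, fderiv_comp_const_sub, neg_neg, divergence]

variable [MeasurableSpace H] [BorelSpace H]

theorem integral_divergence_eq_zero {V : H → H} (hV : ContDiff ℝ 1 V) (hVc : HasCompactSupport V) :
    ∫ y, divergence V y = 0 := by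
  let b := stdOrthonormalBasis ℝ H
  have hV' : Continuous (fderiv ℝ V) := hV.continuous_fderiv one_ne_zero
  have hint (v : H) : Integrable fun y => fderiv ℝ V y v :=
    (hV'.clm_apply continuous_const).integrable_of_hasCompactSupport (hVc.fderiv_apply ℝ v)
  have hzero (v : H) : ∫ y, fderiv ℝ V y v = 0 := by
    simpa using integral_smul_fderiv_eq_neg_fderiv_smul_of_integrable (μ := volume)
      (f := fun _ => (1 : ℝ)) (g := V) (v := v) (by simp) (by simpa using hint v)
      (by simpa using hV.continuous.integrable_of_hasCompactSupport hVc)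
      (fun _ _ => differentiableAt_const _) fun y _ => hV.differentiable one_ne_zero y
  calc ∫ y, divergence V y = ∫ y, ∑ i, inner ℝ (b i) (fderiv ℝ V y (b i)) := by
        simp only [divergence, LinearMap.trace_eq_sum_inner _ b, ContinuousLinearMap.coe_coe]
    _ = ∑ i, inner ℝ (b i) (∫ y, fderiv ℝ V y (b i)) := by
        rw [integral_finsetSum _ fun i _ => (hint (b i)).const_inner (b i)]
        exact Finset.sum_congr rfl fun i _ => integral_inner (hint (b i)) (b i)
    _ = 0 := by simp only [hzero, inner_zero_right, Finset.sum_const_zero]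

lemma memLp_divergence {V : H → H} (hV : ContDiff ℝ 1 V) (hVc : HasCompactSupport V)
    (p : ENNReal) : MemLp (divergence V) p :=
  (continuous_divergence hV).memLp_of_hasCompactSupport (hasCompactSupport_divergence hVc)

lemma integrable_divergence {V : H → H} (hV : ContDiff ℝ 1 V) (hVc : HasCompactSupport V) :
    Integrable (divergence V) :=
  memLp_one_iff_integrable.1 (memLp_divergence hV hVc 1)

lemma setIntegral_divergence_eq_zero {V : H → H} {s : Set H} (hV : ContDiff ℝ 1 V)
    (hVc : HasCompactSupport V) (hVs : tsupport V ⊆ s) : ∫ y in s, divergence V y = 0 := by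
  have hzero (y : H) (hy : y ∉ s) : divergence V y = 0 :=
    image_eq_zero_of_notMem_tsupport (f := divergence V) fun h =>
      hy (hVs (tsupport_divergence_subset V h))
  rw [setIntegral_eq_integral_of_forall_compl_eq_zero hzero, integral_divergence_eq_zero hV hVc]

lemma clm_fderiv_convolution {F W : Type*} [NormedAddCommGroup F] [NormedSpace ℝ F]
    [NormedAddCommGroup W] [NormedSpace ℝ W] [CompleteSpace F] [CompleteSpace W]
    (L : (H →L[ℝ] F) →L[ℝ] W) {g : H → ℝ} {θ : H → F}
    (hg : LocallyIntegrable g) (hθ : ContDiff ℝ 1 θ) (hθc : HasCompactSupport θ) (y : H) :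
    L (fderiv ℝ (g ⋆[.lsmul ℝ ℝ] θ) y) =
      (g ⋆[.lsmul ℝ ℝ] fun z => L (fderiv ℝ θ z)) y := by
  rw [(hθc.hasFDerivAt_convolution_right _ hg hθ y).fderiv, convolution, convolution,
    ← L.integral_comp_comm]
  · exact integral_congr_ae (.of_forall fun t => L.map_smul (g t) (fderiv ℝ θ (y - t)))
  · exact (hθc.fderiv ℝ).convolutionExists_right _ hg (hθ.continuous_fderiv one_ne_zero) y

lemma divergence_gradient_convolution {g θ : H → ℝ} (hg : LocallyIntegrable g)
    (hθ : ContDiff ℝ 2 θ) (hθc : HasCompactSupport θ) (y : H) :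
    divergence (∇ (g ⋆[.lsmul ℝ ℝ] θ)) y = ∫ t, g t * divergence (∇ θ) (y - t) := by
  have hgrad : ∇ (g ⋆[.lsmul ℝ ℝ] θ) = g ⋆[.lsmul ℝ ℝ] ∇ θ := funext fun z =>
    clm_fderiv_convolution
      (L := (InnerProductSpace.toDual ℝ H).symm.toContinuousLinearEquiv.toContinuousLinearMap)
      hg (hθ.of_le one_le_two) hθc z
  rw [hgrad]
  exact clm_fderiv_convolution (traceL H) hg (contDiff_gradient hθ (by norm_num))
    (hasCompactSupport_gradient hθc) y

end VectorCalculus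

lemma eventually_memLp_of_tendsto {α Y : Type*} [MeasurableSpace α] {μ : Measure α}
    [NormedAddCommGroup Y] {p : ENNReal} {f : ℕ → α → Y} {g : α → Y} (hg : MemLp g p μ)
    (hf : ∀ n, AEStronglyMeasurable (f n) μ)
    (hfg : Tendsto (fun n => eLpNorm (fun y => f n y - g y) p μ) atTop (𝓝 0)) :
    ∀ᶠ n in atTop, MemLp (f n) p μ := by
  filter_upwards [hfg.eventually (gt_mem_nhds ENNReal.zero_lt_top)] with n hn
  have hsub : MemLp (fun y => f n y - g y) p μ := ⟨(hf n).sub hg.1, hn⟩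
  simpa [Pi.add_def] using hsub.add hg

lemma tendsto_integral_of_bilin {α X Y W : Type*} [MeasurableSpace α] {μ : Measure α}
    [NormedAddCommGroup X] [NormedSpace ℝ X] [NormedAddCommGroup Y] [NormedSpace ℝ Y]
    [NormedAddCommGroup W] [NormedSpace ℝ W] (B : X →L[ℝ] Y →L[ℝ] W) {h : α → X}
    {f : ℕ → α → Y} {g : α → Y} (hh : MemLp h ⊤ μ) (hg : Integrable g μ)
    (hf : ∀ n, AEStronglyMeasurable (f n) μ)
    (hfg : Tendsto (fun n => eLpNorm (fun y => f n y - g y) 1 μ) atTop (𝓝 0)) :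
    Tendsto (fun n => ∫ y, B (h y) (f n y) ∂μ) atTop (𝓝 (∫ y, B (h y) (g y) ∂μ)) := by
  have hf' := eventually_memLp_of_tendsto (memLp_one_iff_integrable.2 hg) hf hfg
  refine tendsto_integral_of_L1' _ (B.aestronglyMeasurable_comp₂ hh.1 hg.1) ?_ ?_
  · filter_upwards [hf'] with n hn using memLp_one_iff_integrable.1 (B.memLp_of_bilin 1 hh hn)
  · have hle (n : ℕ) : eLpNorm ((fun y => B (h y) (f n y)) - fun y => B (h y) (g y)) 1 μ ≤
        ‖B‖₊ * eLpNorm h ⊤ μ * eLpNorm (fun y => f n y - g y) 1 μ := by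
      simpa only [Pi.sub_def, map_sub] using eLpNorm_le_eLpNorm_mul_eLpNorm_of_nnnorm hh.1
        ((hf n).sub hg.1) (fun v w => B v w) ‖B‖₊ (.of_forall fun y => B.le_opNorm₂ _ _)
    refine tendsto_of_tendsto_of_tendsto_of_le_of_le tendsto_const_nhds ?_ (fun _ => zero_le) hle
    simpa using ENNReal.Tendsto.const_mul hfg
      (.inr (ENNReal.mul_ne_top ENNReal.coe_ne_top hh.2.ne))

lemma tendsto_eLpNorm_zero_of_le_mul {α X Y : Type*} [MeasurableSpace α] {μ : Measure α}
    [NormedAddCommGroup X] [NormedAddCommGroup Y] {f : ℕ → α → X} {g : ℕ → α → Y} {C : ℝ}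
    {p : ENNReal} (hgf : ∀ n, ∀ᵐ y ∂μ, ‖g n y‖ ≤ C * ‖f n y‖)
    (hf : Tendsto (fun n => eLpNorm (f n) p μ) atTop (𝓝 0)) :
    Tendsto (fun n => eLpNorm (g n) p μ) atTop (𝓝 0) := by
  refine tendsto_of_tendsto_of_tendsto_of_le_of_le tendsto_const_nhds ?_ (fun _ => zero_le)
    (fun n => eLpNorm_le_mul_eLpNorm_of_ae_le_mul (hgf n) p)
  simpa using ENNReal.Tendsto.const_mul (a := ENNReal.ofReal C) hf (.inr ENNReal.ofReal_ne_top)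

lemma continuousOn_of_tsupport_subset {X Y : Type*} [TopologicalSpace X] [TopologicalSpace Y]
    [Zero Y] {S P : Set X} {g : X → Y} (hP : IsClosed P) (hg : ContinuousOn g (S \ P))
    (hgP : tsupport g ⊆ Pᶜ) : ContinuousOn g S := by
  intro y hy
  by_cases hyP : y ∈ P
  · exact (continuousAt_const.congr
      (notMem_tsupport_iff_eventuallyEq.1 fun h => hgP h hyP).symm).continuousWithinAt
  · exact (continuousWithinAt_inter (hP.isOpen_compl.mem_nhds hyP)).1 (hg y ⟨hy, hyP⟩)

variable {d : ℕ} {Ω P : Set (E d)} {F F' : Type*} [NormedAddCommGroup F] [NormedSpace ℝ F]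
  [NormedAddCommGroup F'] [NormedSpace ℝ F']

section C1UpToBoundary

lemma isC1UpToBoundary_of_contDiff {f : E d → F} (hf : ContDiff ℝ 1 f) :
    IsC1UpToBoundary Ω ∅ f :=
  ⟨hf.continuous.continuousOn, fderiv ℝ f, (hf.continuous_fderiv one_ne_zero).continuousOn,
    fun y _ => (hf.differentiable one_ne_zero y).hasFDerivAt⟩

namespace IsC1UpToBoundary

lemma clm_comp {f : E d → F} (hf : IsC1UpToBoundary Ω P f) (L : F →L[ℝ] F') :
    IsC1UpToBoundary Ω P fun y => L (f y) := by
  obtain ⟨hc, D, hD, hfD⟩ := hf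
  exact ⟨L.continuous.comp_continuousOn hc, fun y => L.comp (D y),
    continuousOn_const.clm_comp hD, fun y hy => L.hasFDerivAt.comp y (hfD y hy)⟩

lemma differentiableAt {f : E d → F} (hf : IsC1UpToBoundary Ω P f) {y : E d} (hy : y ∈ Ω \ P) :
    DifferentiableAt ℝ f y := by
  obtain ⟨-, D, -, hfD⟩ := hf
  exact (hfD y hy).differentiableAt

lemma continuousOn_fderiv {f : E d → F} (hf : IsC1UpToBoundary Ω P f) :
    ContinuousOn (fderiv ℝ f) (Ω \ P) := by
  obtain ⟨-, D, hD, hfD⟩ := hf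
  exact (hD.mono (sdiff_subset_sdiff_left subset_closure)).congr fun y hy => (hfD y hy).fderiv

lemma contDiffOn {f : E d → F} (hf : IsC1UpToBoundary Ω P f) (hΩP : IsOpen (Ω \ P)) :
    ContDiffOn ℝ 1 f (Ω \ P) := by
  rw [← zero_add 1, contDiffOn_succ_iff_fderiv_of_isOpen hΩP, contDiffOn_zero]
  exact ⟨fun y hy => (hf.differentiableAt hy).differentiableWithinAt, by simp,
    hf.continuousOn_fderiv⟩

lemma contDiff_smul {f : E d → ℝ} {V : E d → F} (hf : IsC1UpToBoundary Ω P f)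
    (hΩP : IsOpen (Ω \ P)) (hV : ContDiff ℝ 1 V) (hVΩ : tsupport V ⊆ Ω \ P) :
    ContDiff ℝ 1 fun y => f y • V y := by
  refine contDiff_iff_contDiffAt.2 fun y => ?_
  by_cases hy : y ∈ tsupport V
  · exact ((hf.contDiffOn hΩP).contDiffAt (hΩP.mem_nhds (hVΩ hy))).smul hV.contDiffAt
  · refine (contDiffAt_const (c := (0 : F))).congr_of_eventuallyEq ?_
    filter_upwards [notMem_tsupport_iff_eventuallyEq.1 hy] with z hz
    simp [hz]

lemma mul_of_tsupport_subset {f ζ : E d → ℝ} (hP : IsClosed P) (hf : IsC1UpToBoundary Ω P f)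
    (hζ : ContDiff ℝ 1 ζ) (hζP : tsupport ζ ⊆ Pᶜ) :
    IsC1UpToBoundary Ω ∅ fun y => ζ y * f y := by
  obtain ⟨hc, D, hD, hfD⟩ := hf
  have hζ' := hζ.continuous_fderiv one_ne_zero
  have hzero {y : E d} (hy : y ∉ tsupport ζ) : ζ y = 0 ∧ fderiv ℝ ζ y = 0 :=
    ⟨image_eq_zero_of_notMem_tsupport hy,
      image_eq_zero_of_notMem_tsupport fun h => hy (tsupport_fderiv_subset ℝ h)⟩
  rw [IsC1UpToBoundary, sdiff_empty, sdiff_empty]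
  refine ⟨continuousOn_of_tsupport_subset hP (hζ.continuous.continuousOn.mul hc)
      (tsupport_mul_subset_left.trans hζP),
    fun y => ζ y • D y + f y • fderiv ℝ ζ y, continuousOn_of_tsupport_subset hP
      ((hζ.continuous.continuousOn.smul hD).add (hc.smul hζ'.continuousOn)) ?_, fun y hy => ?_⟩
  · refine (closure_minimal (fun y hy => ?_) (isClosed_tsupport ζ)).trans hζP
    contrapose! hy
    simp [hzero hy]
  · by_cases hyζ : y ∈ tsupport ζ
    · exact (hζ.differentiable one_ne_zero y).hasFDerivAt.mul (hfD y ⟨hy, hζP hyζ⟩)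
    · simp only [hzero hyζ, zero_smul, smul_zero, add_zero]
      refine (hasFDerivAt_const (0 : ℝ) y).congr_of_eventuallyEq ?_
      filter_upwards [notMem_tsupport_iff_eventuallyEq.1 hyζ] with z hz
      simp [hz]

lemma memLp_fderiv {f : E d → F} (hf : IsC1UpToBoundary Ω ∅ f) (hΩ : IsOpen Ω)
    (hb : Bornology.IsBounded Ω) : MemLp (fderiv ℝ f) ⊤ (volume.restrict Ω) := by
  obtain ⟨-, D, hD, hfD⟩ := id hf
  rw [sdiff_empty] at hD hfD
  obtain ⟨C, hC⟩ := hb.isCompact_closure.exists_bound_of_continuousOn hD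
  have hmeas := hf.continuousOn_fderiv
  rw [sdiff_empty] at hmeas
  refine memLp_top_of_bound (hmeas.aestronglyMeasurable hΩ.measurableSet) C ?_
  filter_upwards [ae_restrict_mem hΩ.measurableSet] with y hy
  rw [(hfD y hy).fderiv]
  exact hC y (subset_closure hy)

lemma memLp_gradient {f : E d → ℝ} (hf : IsC1UpToBoundary Ω ∅ f) (hΩ : IsOpen Ω)
    (hb : Bornology.IsBounded Ω) : MemLp (∇ f) ⊤ (volume.restrict Ω) :=
  (InnerProductSpace.toDual ℝ (E d)).symm.toContinuousLinearEquiv.toContinuousLinearMap.comp_memLp'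
    (hf.memLp_fderiv hΩ hb)

end IsC1UpToBoundary

end C1UpToBoundary

namespace HasW11Grad

lemma clm_comp {u : E d → F} {G : E d → E d →L[ℝ] F} (hu : HasW11Grad Ω u G)
    (hΩ : IsOpen Ω) (L : F →L[ℝ] F') :
    HasW11Grad Ω (fun y => L (u y)) (fun y => L.comp (G y)) := by
  obtain ⟨hui, hGi, hut, φ, hφ, hφu, hφG, hφt⟩ := hu
  have hval (n : ℕ) (y : E d) : ‖L (φ n y) - L (u y)‖ ≤ ‖L‖ * ‖φ n y - u y‖ := by
    simpa using L.le_opNorm (φ n y - u y)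
  refine ⟨L.integrable_comp hui,
    (ContinuousLinearMap.compL ℝ (E d) F F' L).integrable_comp hGi, L.integrable_comp hut,
    fun n y => L (φ n y), fun n => (hφ n).clm_comp L,
    tendsto_eLpNorm_zero_of_le_mul (fun n => .of_forall (hval n)) hφu,
    tendsto_eLpNorm_zero_of_le_mul (C := ‖L‖) (fun n => ?_) hφG,
    tendsto_eLpNorm_zero_of_le_mul (fun n => .of_forall (hval n)) hφt⟩
  filter_upwards [ae_restrict_mem hΩ.measurableSet] with y hy
  have hφy := (hφ n).differentiableAt ⟨hy, notMem_empty y⟩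
  change ‖fderiv ℝ (L ∘ φ n) y - _‖ ≤ _
  rw [(L.hasFDerivAt.comp y hφy.hasFDerivAt).fderiv, ← ContinuousLinearMap.comp_sub]
  exact L.opNorm_comp_le _

lemma integrableOn_apply {u : E d → F} {G : E d → E d →L[ℝ] F} (hu : HasW11Grad Ω u G)
    {X : E d → E d} (hX : MemLp X ⊤ (volume.restrict Ω)) :
    IntegrableOn (fun y => G y (X y)) Ω :=
  memLp_one_iff_integrable.1 ((ContinuousLinearMap.apply ℝ F).memLp_of_bilin 1 hX
    (memLp_one_iff_integrable.2 hu.integrable_grad))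

variable {u h : E d → ℝ} {G : E d → E d →L[ℝ] ℝ} {X V : E d → E d}

lemma integrableOn_mul (hu : HasW11Grad Ω u G) (hh : MemLp h ⊤ (volume.restrict Ω)) :
    IntegrableOn (fun y => h y * u y) Ω :=
  memLp_one_iff_integrable.1 ((ContinuousLinearMap.mul ℝ ℝ).memLp_of_bilin 1 hh
    (memLp_one_iff_integrable.2 hu.integrable))

theorem integral_eq_of_forall_C1 (hu : HasW11Grad Ω u G) (hΩ : IsOpen Ω)
    (hh : MemLp h ⊤ (volume.restrict Ω)) (hX : MemLp X ⊤ (volume.restrict Ω)) {c : ℝ}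
    (H : ∀ φ : E d → ℝ, IsC1UpToBoundary Ω ∅ φ →
      ∫ y in Ω, (h y * φ y + fderiv ℝ φ y (X y)) = c * ∫ y, φ y ∂(surfaceMeasure Ω)) :
    ∫ y in Ω, (h y * u y + G y (X y)) = c * ∫ y, u y ∂(surfaceMeasure Ω) := by
  obtain ⟨hui, hGi, hut, φ, hφ, hφu, hφG, hφt⟩ := id hu
  have hφc (n : ℕ) : ContinuousOn (φ n) (closure Ω) := by simpa using (hφ n).1
  have hmeas {s : Set (E d)} (hs : MeasurableSet s) (hsΩ : s ⊆ closure Ω) (μ : Measure (E d))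
      (n : ℕ) : AEStronglyMeasurable (φ n) (μ.restrict s) :=
    ((hφc n).mono hsΩ).aestronglyMeasurable hs
  have hmeasΩ := hmeas hΩ.measurableSet subset_closure volume
  have hmeas' (n : ℕ) : AEStronglyMeasurable (fderiv ℝ (φ n)) (volume.restrict Ω) :=
    (measurable_fderiv ℝ (φ n)).aestronglyMeasurable
  have hfun := tendsto_integral_of_bilin (.mul ℝ ℝ) hh hui hmeasΩ hφu
  have hgrad := tendsto_integral_of_bilin (.apply ℝ ℝ) hX hGi hmeas' hφG
  have htrace := tendsto_integral_of_bilin (.mul ℝ ℝ) (memLp_top_const (1 : ℝ)) hut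
    (hmeas isClosed_frontier.measurableSet frontier_subset_closure _) hφt
  simp only [ContinuousLinearMap.mul_apply', ContinuousLinearMap.apply_apply, one_mul]
    at hfun hgrad htrace
  have hφ_int : ∀ᶠ n in atTop, c * ∫ y, φ n y ∂(surfaceMeasure Ω) =
      (∫ y in Ω, h y * φ n y) + ∫ y in Ω, fderiv ℝ (φ n) y (X y) := by
    filter_upwards [eventually_memLp_of_tendsto (memLp_one_iff_integrable.2 hui) hmeasΩ hφu,
      eventually_memLp_of_tendsto (memLp_one_iff_integrable.2 hGi) hmeas' hφG] with n hn hn'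
    rw [← H (φ n) (hφ n)]
    exact integral_add
      (memLp_one_iff_integrable.1 ((ContinuousLinearMap.mul ℝ ℝ).memLp_of_bilin 1 hh hn))
      (memLp_one_iff_integrable.1 ((ContinuousLinearMap.apply ℝ ℝ).memLp_of_bilin 1 hX hn'))
  rw [integral_add (hu.integrableOn_mul hh) (hu.integrableOn_apply hX)]
  exact tendsto_nhds_unique (hfun.add hgrad) ((htrace.const_mul c).congr' hφ_int)

lemma integrableOn_divergence_mul_add_apply (hu : HasW11Grad Ω u G) (hV : ContDiff ℝ 1 V)
    (hVc : HasCompactSupport V) :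
    IntegrableOn (fun y => divergence V y * u y + G y (V y)) Ω :=
  (hu.integrableOn_mul ((memLp_divergence hV hVc ⊤).restrict Ω)).add
    (hu.integrableOn_apply ((hV.continuous.memLp_of_hasCompactSupport hVc).restrict Ω))

theorem integral_divergence (hu : HasW11Grad Ω u G) (hΩ : IsOpen Ω) (hV : ContDiff ℝ 1 V)
    (hVc : HasCompactSupport V) (hVΩ : tsupport V ⊆ Ω) :
    ∫ y in Ω, (divergence V y * u y + G y (V y)) = 0 := by
  have hVL : MemLp V ⊤ (volume.restrict Ω) :=
    (hV.continuous.memLp_of_hasCompactSupport hVc).restrict Ω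
  have H (φ : E d → ℝ) (hφ : IsC1UpToBoundary Ω ∅ φ) :
      ∫ y in Ω, (divergence V y * φ y + fderiv ℝ φ y (V y)) =
        0 * ∫ y, φ y ∂(surfaceMeasure Ω) := by
    have hφV : ContDiff ℝ 1 fun y => φ y • V y :=
      hφ.contDiff_smul (by simpa using hΩ) hV (by simpa using hVΩ)
    have hφVc : HasCompactSupport fun y => φ y • V y := hVc.smul_left (f := φ)
    rw [zero_mul, ← setIntegral_divergence_eq_zero hφV hφVc
      ((tsupport_smul_subset_right φ V).trans hVΩ)]
    refine setIntegral_congr_fun hΩ.measurableSet fun y hy => ?_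
    rw [divergence_smul (hφ.differentiableAt ⟨hy, notMem_empty y⟩)
      (hV.differentiable one_ne_zero y), mul_comm]
  rw [hu.integral_eq_of_forall_C1 hΩ ((memLp_divergence hV hVc ⊤).restrict Ω) hVL H, zero_mul]

end HasW11Grad

section WeaklyHarmonic

lemma exists_pos_forall_dist_le_of_isCompact {X : Type*} [PseudoMetricSpace X] [ProperSpace X]
    {B k : Set X} {u : X → ℝ} (hB : IsOpen B) (hu : ContinuousOn u B) (hk : IsCompact k)
    (hkB : k ⊆ B) {ε : ℝ} (hε : 0 < ε) :
    ∃ r > 0, ∀ y ∈ k, ∀ z ∈ Metric.closedBall y r, z ∈ B ∧ dist (u z) (u y) ≤ ε := by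
  obtain ⟨δ, hδ, hδB⟩ := hk.exists_cthickening_subset_open hB hkB
  obtain ⟨η, hη, hηu⟩ := Metric.uniformContinuousOn_iff.1
    (hk.cthickening.uniformContinuousOn_of_continuous (hu.mono hδB)) ε hε
  refine ⟨min δ (η / 2), by positivity, fun y hy z hz => ?_⟩
  have hzδ : z ∈ Metric.cthickening δ k :=
    Metric.mem_cthickening_of_dist_le z y δ k hy (hz.trans (min_le_left _ _))
  exact ⟨hδB hzδ, (hηu z hzδ y (Metric.self_subset_cthickening k hy)
    ((hz.trans (min_le_right _ _)).trans_lt (half_lt_self hη))).le⟩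

variable {H : Type*} [NormedAddCommGroup H] [InnerProductSpace ℝ H] [FiniteDimensional ℝ H]
  [MeasurableSpace H] [BorelSpace H] {B k : Set H} {u : H → ℝ}

/-- `u` satisfies the Laplace equation in `B` in the sense of distributions. Only the values of `u`
in `B` matter, since the test functions vanish off `B`. -/
def IsWeaklyHarmonicOn (u : H → ℝ) (B : Set H) : Prop :=
  ∀ ψ : H → ℝ, ContDiff ℝ ∞ ψ → HasCompactSupport ψ → tsupport ψ ⊆ B →
    ∫ y, u y * divergence (∇ ψ) y = 0

lemma IsWeaklyHarmonicOn.divergence_gradient_convolution_eq_zero (h : IsWeaklyHarmonicOn u B)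
    (hB : IsOpen B) (hui : IntegrableOn u B) {θ : H → ℝ} (hθ : ContDiff ℝ ∞ θ)
    (hθc : HasCompactSupport θ) {y : H} (hθB : tsupport (fun t => θ (y - t)) ⊆ B) :
    divergence (∇ (B.indicator u ⋆[.lsmul ℝ ℝ] θ)) y = 0 := by
  have hg : Integrable (B.indicator u) := (integrable_indicator_iff hB.measurableSet).2 hui
  rw [divergence_gradient_convolution hg.locallyIntegrable (contDiff_infty.1 hθ 2) hθc,
    ← h (fun t => θ (y - t)) (hθ.comp (contDiff_const.sub contDiff_id))
      (hθc.comp_homeomorph (Homeomorph.subLeft y)) hθB]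
  refine integral_congr_ae (.of_forall fun t => ?_)
  simp only [← divergence_gradient_comp_const_sub]
  by_cases ht : t ∈ B
  · rw [indicator_of_mem ht]
  · rw [image_eq_zero_of_notMem_tsupport fun h =>
      ht (hθB (tsupport_gradient_subset _ (tsupport_divergence_subset _ h))), mul_zero, mul_zero]

theorem IsWeaklyHarmonicOn.exists_harmonic_dist_le (h : IsWeaklyHarmonicOn u B) (hB : IsOpen B)
    (hui : IntegrableOn u B) (hu : ContinuousOn u B) (hk : IsCompact k) (hkB : k ⊆ B) {ε : ℝ}
    (hε : 0 < ε) :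
    ∃ v : H → ℝ, ContDiff ℝ ∞ v ∧ (∀ y ∈ k, divergence (∇ v) y = 0) ∧
      ∀ y ∈ k, dist (v y) (u y) ≤ ε := by
  obtain ⟨r, hr, hru⟩ := exists_pos_forall_dist_le_of_isCompact hB hu hk hkB hε
  let χ : ContDiffBump (0 : H) := ⟨r / 2, r, half_pos hr, half_lt_self hr⟩
  let θ : H → ℝ := χ.normed volume
  have hg : Integrable (B.indicator u) := (integrable_indicator_iff hB.measurableSet).2 hui
  have hgu {z : H} (hz : z ∈ B) : B.indicator u z = u z := indicator_of_mem hz u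
  refine ⟨B.indicator u ⋆[.lsmul ℝ ℝ] θ, χ.hasCompactSupport_normed.contDiff_convolution_right _
    hg.locallyIntegrable χ.contDiff_normed, fun y hy => ?_, fun y hy => ?_⟩
  · have hsupp : tsupport (fun t => θ (y - t)) ⊆ Metric.closedBall y r := by
      refine closure_minimal (fun t ht => ?_) Metric.isClosed_closedBall
      have hyt : y - t ∈ Metric.ball (0 : H) r := χ.support_normed_eq (μ := volume) ▸ ht
      rw [Metric.mem_closedBall, dist_comm, dist_eq_norm]
      exact (mem_ball_zero_iff.1 hyt).le
    exact h.divergence_gradient_convolution_eq_zero hB hui χ.contDiff_normed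
      χ.hasCompactSupport_normed (hsupp.trans fun z hz => (hru y hy z hz).1)
  · have hswap : (B.indicator u ⋆[.lsmul ℝ ℝ] θ) = θ ⋆[.lsmul ℝ ℝ] B.indicator u := by
      rw [← convolution_flip]
      congr 1
      ext
      simp
    rw [hswap]
    refine dist_convolution_le hε.le χ.support_normed_eq.subset χ.nonneg_normed χ.integral_normed
      hg.1 fun z hz => ?_
    rw [hgu (hru y hy z (Metric.ball_subset_closedBall hz)).1]
    exact (hru y hy z (Metric.ball_subset_closedBall hz)).2

theorem IsWeaklyHarmonicOn.eq_setIntegral_mul (h : IsWeaklyHarmonicOn u B) (hB : IsOpen B)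
    (hui : IntegrableOn u B) (hu : ContinuousOn u B) (hk : IsCompact k) (hkB : k ⊆ B)
    {K : H → ℝ} (hK : IntegrableOn K k) {x : H} (hx : x ∈ k)
    (hrep : ∀ v : H → ℝ, ContDiff ℝ ∞ v → (∀ y ∈ k, divergence (∇ v) y = 0) →
      v x = ∫ y in k, v y * K y) :
    u x = ∫ y in k, u y * K y := by
  set M : ℝ := ∫ y in k, ‖K y‖
  have hM : 0 ≤ M := integral_nonneg fun y => norm_nonneg (K y)
  refine eq_of_forall_dist_le fun ε hε => ?_
  obtain ⟨v, hv, hvk, hvu⟩ := h.exists_harmonic_dist_le hB hui hu hk hkB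
    (ε := ε / (1 + M)) (by positivity)
  have hdiff : ‖∫ y in k, (v y - u y) * K y‖ ≤ ε / (1 + M) * M := by
    rw [← integral_const_mul]
    refine norm_integral_le_of_norm_le (hK.norm.const_mul _) ?_
    filter_upwards [ae_restrict_mem hk.measurableSet] with y hy
    rw [norm_mul]
    exact mul_le_mul_of_nonneg_right (hvu y hy) (norm_nonneg _)
  have hsub : ∫ y in k, (v y - u y) * K y = v x - ∫ y in k, u y * K y := by
    simp only [sub_mul]
    rw [integral_sub (hK.continuousOn_mul hv.continuous.continuousOn hk)
      (hK.continuousOn_mul (hu.mono hkB) hk), hrep v hv hvk]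
  calc dist (u x) (∫ y in k, u y * K y)
      ≤ dist (u x) (v x) + dist (v x) (∫ y in k, u y * K y) := dist_triangle _ _ _
    _ ≤ ε / (1 + M) + ε / (1 + M) * M := by
        rw [Real.dist_eq (v x), ← hsub]
        exact add_le_add (dist_comm (u x) _ ▸ hvu x hx) hdiff
    _ = ε := by field_simp

end WeaklyHarmonic

section PointSources

lemma gradDot_fderiv (A : E d →L[ℝ] F) (φ : E d → ℝ) (y : E d) :
    gradDot A (fderiv ℝ φ y) = A (∇ φ y) := by
  have hsum : ∇ φ y =
      ∑ i, fderiv ℝ φ y (EuclideanSpace.single i 1) • EuclideanSpace.single i 1 := by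
    conv_lhs => rw [← (EuclideanSpace.basisFun (Fin d) ℝ).sum_repr' (∇ φ y)]
    simp only [EuclideanSpace.basisFun_apply, real_inner_comm, ← inner_gradient_left]
  rw [hsum, map_sum]
  simp [gradDot]

/-- The field `G` is a weak solution of `-div G = ∑ i, a i δ_{p i}` in `Ω` with constant
Neumann datum `-b` on `∂Ω`; sources `p i` on `∂Ω` act as point electrodes. -/
def HasPointSources {ι : Type*} [Fintype ι] (Ω : Set (E d)) (G : E d → E d →L[ℝ] F)
    (p : ι → E d) (a : ι → F) (b : F) : Prop :=
  ∀ φ : E d → ℝ, IsC1UpToBoundary Ω ∅ φ →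
    ∫ y in Ω, G y (∇ φ y) = ∑ i, φ (p i) • a i - (∫ y, φ y ∂(surfaceMeasure Ω)) • b

/-- `f` is a Green function of `Ω` with pole `x` and constant Neumann datum `-c`: the properties of
a Neumann function `N x` that do not involve the normalization of its mean or other poles. -/
structure HasUnitPole (Ω : Set (E d)) (x : E d) (c : ℝ) (f : E d → ℝ) : Prop where
  isC1 : IsC1UpToBoundary Ω {x} f
  hasW11Grad : HasW11Grad Ω f (fderiv ℝ f)
  weak_form : ∀ φ : E d → ℝ, IsC1UpToBoundary Ω ∅ φ →
    ∫ y in Ω, fderiv ℝ f y (∇ φ y) = φ x - c * ∫ y, φ y ∂(surfaceMeasure Ω)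

lemma IsNeumannFunction.hasUnitPole {N : E d → E d → ℝ} (hN : IsNeumannFunction Ω N) {x : E d}
    (hx : x ∈ Ω) : HasUnitPole Ω x (1 / (surfaceMeasure Ω).real univ) (N x) where
  isC1 := hN.isC1 x hx
  hasW11Grad := hN.hasW11Grad x hx
  weak_form φ hφ := by simpa only [gradDot_fderiv] using hN.weak_form x hx φ hφ

lemma HasUnitPole.hasPointSources {x : E d} {c : ℝ} {f : E d → ℝ} (hf : HasUnitPole Ω x c f) :
    HasPointSources Ω (fderiv ℝ f) (fun _ : Unit => x) (fun _ => 1) c := fun φ hφ => by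
  simpa [mul_comm c] using hf.weak_form φ hφ

lemma HasW11Grad.hasPointSources_clm_comp [CompleteSpace F] [CompleteSpace F'] {ι : Type*}
    [Fintype ι] {u : E d → F} {G : E d → E d →L[ℝ] F} {p : ι → E d} {a : ι → F} {b : F}
    (hu : HasW11Grad Ω u G) (hG : HasPointSources Ω G p a b) (hΩ : IsOpen Ω)
    (hb : Bornology.IsBounded Ω) (L : F →L[ℝ] F') :
    HasPointSources Ω (fun y => L.comp (G y)) p (fun i => L (a i)) (L b) := fun φ hφ => by
  simp only [ContinuousLinearMap.comp_apply]
  rw [L.integral_comp_comm (hu.integrableOn_apply (hφ.memLp_gradient hΩ hb)), hG φ hφ]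
  simp

lemma HasW11Grad.isWeaklyHarmonicOn {ι : Type*} [Fintype ι] {u : E d → ℝ}
    {G : E d → E d →L[ℝ] ℝ} {p : ι → E d} {a : ι → ℝ} {b : ℝ} (hu : HasW11Grad Ω u G)
    (hG : HasPointSources Ω G p a b) (hΩ : IsOpen Ω) :
    IsWeaklyHarmonicOn u (Ω \ range p) := by
  intro ψ hψ hψc hψΩ
  have hzero {y : E d} (hy : y ∉ Ω \ range p) : ψ y = 0 :=
    image_eq_zero_of_notMem_tsupport fun h => hy (hψΩ h)
  have hψ1 : ContDiff ℝ 1 (∇ ψ) :=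
    contDiff_gradient (contDiff_infty.1 hψ 2) (by norm_num)
  have hgc := hasCompactSupport_gradient hψc
  have hdiv := hu.integral_divergence hΩ hψ1 hgc
    ((tsupport_gradient_subset ψ).trans (hψΩ.trans sdiff_subset))
  have hsource : ∫ y in Ω, G y (∇ ψ y) = 0 := by
    have hψs : ∫ y, ψ y ∂(surfaceMeasure Ω) = 0 :=
      setIntegral_eq_zero_of_forall_eq_zero fun y hy =>
        hzero fun h => (hΩ.frontier_eq ▸ hy).2 h.1
    simp [hG ψ (isC1UpToBoundary_of_contDiff (contDiff_infty.1 hψ 1)), hψs,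
      fun i => hzero fun h : p i ∈ Ω \ range p => h.2 (mem_range_self i)]
  rw [integral_add (hu.integrableOn_mul ((memLp_divergence hψ1 hgc ⊤).restrict Ω))
    (hu.integrableOn_apply ((hψ1.continuous.memLp_of_hasCompactSupport hgc).restrict Ω)),
    hsource, add_zero] at hdiv
  rw [← hdiv, setIntegral_eq_integral_of_forall_compl_eq_zero fun y hy => ?_]
  · simp only [mul_comm]
  · rw [image_eq_zero_of_notMem_tsupport fun h => hy (hψΩ (tsupport_gradient_subset ψ
      (tsupport_divergence_subset _ h))).1, zero_mul]

end PointSources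

section PoleKernel

variable {x : E d} {c : ℝ} {f : E d → ℝ}

/-- The commutator of the Laplacian with multiplication by the cutoff `χ`, applied to `f`:
`poleKernel f χ` is `Δ(χ f)` where `f` is harmonic, in a form that uses one derivative of `f` only.
Pairing with it recovers the value at the pole of `f` of a function that is harmonic near it. -/
noncomputable def poleKernel (f χ : E d → ℝ) (y : E d) : ℝ :=
  fderiv ℝ f y (∇ χ y) + divergence (fun z => f z • ∇ χ z) y

lemma gradient_one_sub_bump_mul (χ : ContDiffBump x) {g : E d → ℝ} {y : E d}
    (hg : y ≠ x → DifferentiableAt ℝ g y) :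
    ∇ (fun z => (1 - χ z) * g z) y = (1 - χ y) • ∇ g y - g y • ∇ χ y := by
  by_cases hy : y = x
  · subst hy
    have hχ := χ.eventuallyEq_one
    have hzero : (fun z => (1 - χ z) * g z) =ᶠ[𝓝 y] fun _ => 0 := by
      filter_upwards [hχ] with z hz
      simp [hz]
    simp [gradient, hzero.fderiv_eq, hχ.fderiv_eq, hχ.eq_of_nhds]
  · have hχ : DifferentiableAt ℝ χ y := (χ.contDiff (n := 1)).differentiable one_ne_zero y
    rw [gradient_mul (hχ.const_sub 1) (hg hy)]
    simp [gradient, sub_eq_add_neg]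

lemma tsupport_gradient_bump_subset (χ : ContDiffBump x) :
    tsupport (∇ χ) ⊆ Metric.closedBall x χ.rOut \ {x} := by
  refine subset_sdiff_singleton ((tsupport_gradient_subset χ).trans χ.tsupport_eq.subset) ?_
  rw [notMem_tsupport_iff_eventuallyEq]
  filter_upwards [χ.eventuallyEq_one.eventuallyEq_nhds] with y hy
  simp [gradient, hy.fderiv_eq]

lemma fderiv_gradient_mul_eq {f v χ : E d → ℝ} {y : E d} (hχ : DifferentiableAt ℝ χ y)
    (hv : DifferentiableAt ℝ v y) (hgv : DifferentiableAt ℝ (∇ v) y)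
    (hV : DifferentiableAt ℝ (fun z => f z • ∇ χ z) y) (hvχ : χ y * divergence (∇ v) y = 0) :
    fderiv ℝ f y (∇ (fun z => χ z * v z) y) = v y * poleKernel f χ y +
      ((divergence (fun z => χ z • ∇ v z) y * f y + fderiv ℝ f y (χ y • ∇ v y)) -
        divergence (fun z => v z • f z • ∇ χ z) y) := by
  rw [gradient_mul hχ hv, divergence_smul hχ hgv, divergence_smul hv hV, hvχ,
    fderiv_gradient_comm χ v, poleKernel]
  simp only [map_add, map_smul, smul_eq_mul]
  ring

lemma hasCompactSupport_smul_gradient_bump (f : E d → ℝ) (χ : ContDiffBump x) :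
    HasCompactSupport fun y => f y • ∇ χ y :=
  (hasCompactSupport_gradient χ.hasCompactSupport).smul_left (f := f)

variable {χ : ContDiffBump x}

lemma gradient_bump_eq_zero {y : E d} (hy : y ∉ Metric.closedBall x χ.rOut) : ∇ χ y = 0 :=
  image_eq_zero_of_notMem_tsupport fun h => hy (tsupport_gradient_bump_subset χ h).1

lemma poleKernel_eq_zero {y : E d} (hy : y ∉ Metric.closedBall x χ.rOut) :
    poleKernel f χ y = 0 := by
  have hy' : y ∉ tsupport (∇ χ) := fun h => hy (tsupport_gradient_bump_subset χ h).1
  have hdiv : divergence (fun z => f z • ∇ χ z) y = 0 :=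
    image_eq_zero_of_notMem_tsupport fun h => hy'
      (tsupport_smul_subset_right f (∇ χ) (tsupport_divergence_subset _ h))
  rw [poleKernel, hdiv, image_eq_zero_of_notMem_tsupport hy', map_zero, add_zero]

lemma hasCompactSupport_poleKernel : HasCompactSupport (poleKernel f χ) :=
  .intro (isCompact_closedBall x χ.rOut) fun _ hy => poleKernel_eq_zero hy

namespace HasUnitPole

lemma contDiff_smul_gradient (hf : HasUnitPole Ω x c f) (hΩ : IsOpen Ω)
    (hχ : Metric.closedBall x χ.rOut ⊆ Ω) : ContDiff ℝ 1 fun y => f y • ∇ χ y :=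
  hf.isC1.contDiff_smul (hΩ.sdiff isClosed_singleton)
    (contDiff_gradient (χ.contDiff (n := 2)) (by norm_num))
    ((tsupport_gradient_bump_subset χ).trans (sdiff_subset_sdiff_left hχ))

lemma continuous_fderiv_gradient (hf : HasUnitPole Ω x c f) (hΩ : IsOpen Ω)
    (hχ : Metric.closedBall x χ.rOut ⊆ Ω) : Continuous fun y => fderiv ℝ f y (∇ χ y) := by
  have hsub : tsupport (fun y => fderiv ℝ f y (∇ χ y)) ⊆ tsupport (∇ χ) :=
    closure_mono fun y hy h => hy (by simp only [h, map_zero])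
  have hcont : Continuous (∇ χ) :=
    (contDiff_gradient (m := 0) (χ.contDiff (n := 1)) (by norm_num)).continuous
  exact (hf.isC1.continuousOn_fderiv.clm_apply hcont.continuousOn).continuous_of_tsupport_subset
    (hΩ.sdiff isClosed_singleton)
    (hsub.trans ((tsupport_gradient_bump_subset χ).trans (sdiff_subset_sdiff_left hχ)))

lemma continuous_poleKernel (hf : HasUnitPole Ω x c f) (hΩ : IsOpen Ω)
    (hχ : Metric.closedBall x χ.rOut ⊆ Ω) : Continuous (poleKernel f χ) :=
  (hf.continuous_fderiv_gradient hΩ hχ).add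
    (continuous_divergence (hf.contDiff_smul_gradient hΩ hχ))

lemma integrableOn_mul_poleKernel (hf : HasUnitPole Ω x c f) (hΩ : IsOpen Ω)
    (hχ : Metric.closedBall x χ.rOut ⊆ Ω) {v : E d → ℝ} (hv : Continuous v) :
    IntegrableOn (fun y => v y * poleKernel f χ y) Ω :=
  ((hv.mul (hf.continuous_poleKernel hΩ hχ)).integrable_of_hasCompactSupport
    (hasCompactSupport_poleKernel.mul_left)).integrableOn

lemma eq_setIntegral_mul_poleKernel_of_harmonic (hf : HasUnitPole Ω x c f) (hΩ : IsOpen Ω)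
    (hχ : Metric.closedBall x χ.rOut ⊆ Ω) {v : E d → ℝ} (hv : ContDiff ℝ ∞ v)
    (hvχ : ∀ y ∈ Metric.closedBall x χ.rOut, divergence (∇ v) y = 0) :
    v x = ∫ y in Ω, v y * poleKernel f χ y := by
  have hv1 (y : E d) : DifferentiableAt ℝ v y := hv.differentiable (by simp) y
  have hχ1 (y : E d) : DifferentiableAt ℝ χ y := (χ.contDiff (n := 1)).differentiable one_ne_zero y
  have hgv : ContDiff ℝ 1 (∇ v) := contDiff_gradient (contDiff_infty.1 hv 2) (by norm_num)
  have hχgv : ContDiff ℝ 1 fun y => χ y • ∇ v y := χ.contDiff.smul hgv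
  have hχgvc : HasCompactSupport fun y => χ y • ∇ v y := χ.hasCompactSupport.smul_right
  have htest := hf.weak_form (fun y => χ y * v y)
    (isC1UpToBoundary_of_contDiff (χ.contDiff.mul (contDiff_infty.1 hv 1)))
  have hIBP := hf.hasW11Grad.integral_divergence hΩ hχgv hχgvc
    ((tsupport_smul_subset_left χ (∇ v)).trans (χ.tsupport_eq.trans_subset hχ))
  have hV := hf.contDiff_smul_gradient hΩ hχ
  have hvV : ContDiff ℝ 1 fun y => v y • f y • ∇ χ y := (contDiff_infty.1 hv 1).smul hV
  have hvVc : HasCompactSupport fun y => v y • f y • ∇ χ y :=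
    (hasCompactSupport_smul_gradient_bump f χ).smul_left (f := v)
  have hvVs : tsupport (fun y => v y • f y • ∇ χ y) ⊆ Ω :=
    (tsupport_smul_subset_right v _).trans ((tsupport_smul_subset_right f _).trans
      ((tsupport_gradient_bump_subset χ).trans (sdiff_subset.trans hχ)))
  have hflux := setIntegral_divergence_eq_zero hvV hvVc hvVs
  have hχ0 {y : E d} (hy : y ∉ Metric.closedBall x χ.rOut) : χ y = 0 :=
    χ.zero_of_le_dist (not_le.1 hy).le
  have hχv (y : E d) : χ y * divergence (∇ v) y = 0 := by
    by_cases hy : y ∈ Metric.closedBall x χ.rOut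
    · rw [hvχ y hy, mul_zero]
    · rw [hχ0 hy, zero_mul]
  have hχs : ∫ y, χ y * v y ∂(surfaceMeasure Ω) = 0 :=
    setIntegral_eq_zero_of_forall_eq_zero fun y hy => by
      rw [hχ0 fun h => (hΩ.frontier_eq ▸ hy).2 (hχ h), zero_mul]
  simp only [fun y => fderiv_gradient_mul_eq (f := f) (hχ1 y) (hv1 y)
    (hgv.differentiable one_ne_zero y) (hV.differentiable one_ne_zero y) (hχv y)] at htest
  have hIBPi := hf.hasW11Grad.integrableOn_divergence_mul_add_apply hχgv hχgvc
  have hfluxi := (integrable_divergence hvV hvVc).integrableOn (s := Ω)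
  rw [integral_add (hf.integrableOn_mul_poleKernel hΩ hχ hv.continuous) (hIBPi.sub' hfluxi),
    integral_sub hIBPi hfluxi, hIBP, hflux] at htest
  simpa [hχs, χ.eventuallyEq_one.eq_of_nhds] using htest.symm

theorem eq_setIntegral_mul_poleKernel (hf : HasUnitPole Ω x c f) (hΩ : IsOpen Ω) {B : Set (E d)}
    (hB : IsOpen B) (hBΩ : B ⊆ Ω) (hχ : Metric.closedBall x χ.rOut ⊆ B) {u : E d → ℝ}
    (hu : IsWeaklyHarmonicOn u B) (hui : IntegrableOn u B) (huc : ContinuousOn u B) :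
    u x = ∫ y in Ω, u y * poleKernel f χ y := by
  have hχΩ := hχ.trans hBΩ
  have hball (w : E d → ℝ) : ∫ y in Ω, w y * poleKernel f χ y =
      ∫ y in Metric.closedBall x χ.rOut, w y * poleKernel f χ y :=
    setIntegral_eq_of_subset_of_forall_sdiff_eq_zero hΩ.measurableSet hχΩ fun y hy => by
      rw [poleKernel_eq_zero hy.2, mul_zero]
  have hK := (hf.continuous_poleKernel hΩ hχΩ).integrable_of_hasCompactSupport
    (μ := volume) hasCompactSupport_poleKernel
  rw [hball]
  refine hu.eq_setIntegral_mul hB hui huc (isCompact_closedBall x χ.rOut) hχ hK.integrableOn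
    (Metric.mem_closedBall_self χ.rOut_pos.le) fun v hv hvχ => ?_
  rw [← hball, ← hf.eq_setIntegral_mul_poleKernel_of_harmonic hΩ hχΩ hv hvχ]

variable {u : E d → ℝ} {G : E d → E d →L[ℝ] ℝ}

lemma isC1UpToBoundary_cutoff (hf : HasUnitPole Ω x c f) (χ : ContDiffBump x) :
    IsC1UpToBoundary Ω ∅ fun y => (1 - χ y) * f y := by
  refine hf.isC1.mul_of_tsupport_subset isClosed_singleton (contDiff_const.sub χ.contDiff) ?_
  rw [subset_compl_singleton_iff, notMem_tsupport_iff_eventuallyEq]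
  filter_upwards [χ.eventuallyEq_one] with y hy
  simp [hy]

lemma integral_cutoff_C1 (hf : HasUnitPole Ω x c f) (hΩ : IsOpen Ω)
    (hχ : Metric.closedBall x χ.rOut ⊆ Ω) {φ : E d → ℝ} (hφ : IsC1UpToBoundary Ω ∅ φ) :
    ∫ y in Ω, (-fderiv ℝ f y (∇ χ y) * φ y +
      fderiv ℝ φ y (∇ (fun z => (1 - χ z) * f z) y + f y • ∇ χ y)) =
      -c * ∫ y, φ y ∂(surfaceMeasure Ω) := by
  have htest := hf.weak_form (fun y => (1 - χ y) * φ y)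
    (hφ.mul_of_tsupport_subset isClosed_empty (contDiff_const.sub χ.contDiff) (by simp))
  have hboundary : ∫ y, (1 - χ y) * φ y ∂(surfaceMeasure Ω) = ∫ y, φ y ∂(surfaceMeasure Ω) := by
    refine setIntegral_congr_fun isClosed_frontier.measurableSet fun y hy => ?_
    have hy' : y ∉ Metric.closedBall x χ.rOut := fun h => (hΩ.frontier_eq ▸ hy).2 (hχ h)
    simp [χ.zero_of_le_dist (not_le.1 hy').le]
  rw [hboundary, χ.eventuallyEq_one.eq_of_nhds, Pi.one_apply, sub_self, zero_mul, zero_sub,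
    ← neg_mul] at htest
  rw [← htest]
  refine setIntegral_congr_fun hΩ.measurableSet fun y hy => ?_
  have hφy := hφ.differentiableAt ⟨hy, notMem_empty y⟩
  rw [gradient_one_sub_bump_mul χ fun hyx => hf.isC1.differentiableAt ⟨hy, hyx⟩,
    gradient_one_sub_bump_mul χ fun _ => hφy, sub_add_cancel]
  simp only [map_sub, map_smul, smul_eq_mul, fderiv_gradient_comm φ f]
  ring

theorem integral_apply_gradient_cutoff (hf : HasUnitPole Ω x c f) (hΩ : IsOpen Ω)
    (hb : Bornology.IsBounded Ω) (hχ : Metric.closedBall x χ.rOut ⊆ Ω) (hu : HasW11Grad Ω u G) :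
    ∫ y in Ω, G y (∇ (fun z => (1 - χ z) * f z) y) =
      (∫ y in Ω, u y * poleKernel f χ y) - c * ∫ y, u y ∂(surfaceMeasure Ω) := by
  have hV := hf.contDiff_smul_gradient hΩ hχ
  have hVc := hasCompactSupport_smul_gradient_bump f χ
  have hk : MemLp (fun y => -fderiv ℝ f y (∇ χ y)) ⊤ (volume.restrict Ω) :=
    ((hf.continuous_fderiv_gradient hΩ hχ).neg.memLp_of_hasCompactSupport
      (.intro (isCompact_closedBall x χ.rOut) fun y hy => by
        simp [gradient_bump_eq_zero hy])).restrict Ω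
  have hX : MemLp (fun y => ∇ (fun z => (1 - χ z) * f z) y + f y • ∇ χ y) ⊤
      (volume.restrict Ω) := ((hf.isC1UpToBoundary_cutoff χ).memLp_gradient hΩ hb).add
    ((hV.continuous.memLp_of_hasCompactSupport (μ := volume) (p := ⊤) hVc).restrict Ω)
  have hK : MemLp (poleKernel f χ) ⊤ (volume.restrict Ω) :=
    ((hf.continuous_poleKernel hΩ hχ).memLp_of_hasCompactSupport
      hasCompactSupport_poleKernel).restrict Ω
  have hpole := hu.integral_eq_of_forall_C1 hΩ hk hX fun φ hφ => hf.integral_cutoff_C1 hΩ hχ hφ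
  have hflux := hu.integral_divergence hΩ hV hVc ((tsupport_smul_subset_right f _).trans
    ((tsupport_gradient_bump_subset χ).trans (sdiff_subset.trans hχ)))
  have hpolei := (hu.integrableOn_mul hk).fun_add (hu.integrableOn_apply hX)
  have hfluxi := hu.integrableOn_divergence_mul_add_apply hV hVc
  calc ∫ y in Ω, G y (∇ (fun z => (1 - χ z) * f z) y)
      = ∫ y in Ω, (poleKernel f χ y * u y + (-fderiv ℝ f y (∇ χ y) * u y +
          G y (∇ (fun z => (1 - χ z) * f z) y + f y • ∇ χ y)) -
          (divergence (fun z => f z • ∇ χ z) y * u y + G y (f y • ∇ χ y))) := by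
        refine integral_congr_ae (.of_forall fun y => ?_)
        simp only [poleKernel, map_add]
        ring
    _ = (∫ y in Ω, poleKernel f χ y * u y) + -c * ∫ y, u y ∂(surfaceMeasure Ω) - 0 := by
        rw [← hpole, ← hflux, ← integral_add (hu.integrableOn_mul hK) hpolei,
          ← integral_sub ((hu.integrableOn_mul hK).fun_add hpolei) hfluxi]
    _ = (∫ y in Ω, u y * poleKernel f χ y) - c * ∫ y, u y ∂(surfaceMeasure Ω) := by
        simp only [mul_comm (u _)]
        ring

end HasUnitPole

end PoleKernel

section GreenRepresentation

variable {ι : Type*} [Fintype ι] {x : E d} {c : ℝ} {f : E d → ℝ} {p : ι → E d}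

lemma HasUnitPole.eq_sum_mul_of_hasPointSources (hf : HasUnitPole Ω x c f) (hx : x ∈ Ω)
    (hf0 : ∫ y, f y ∂(surfaceMeasure Ω) = 0) (hΩ : IsOpen Ω) (hb : Bornology.IsBounded Ω)
    {u : E d → ℝ} {G : E d → E d →L[ℝ] ℝ} {a : ι → ℝ} {b : ℝ} (hu : HasW11Grad Ω u G)
    (hG : HasPointSources Ω G p a b) (huc : ContinuousOn u (Ω \ range p))
    (hu0 : ∫ y, u y ∂(surfaceMeasure Ω) = 0) (hxp : x ∉ range p) :
    u x = ∑ i, f (p i) * a i := by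
  have hB : IsOpen (Ω \ range p) := hΩ.sdiff (finite_range p).isClosed
  obtain ⟨r, hr, hrB⟩ := Metric.nhds_basis_closedBall.mem_iff.1 (hB.mem_nhds ⟨hx, hxp⟩)
  let χ : ContDiffBump x := ⟨r / 2, r, half_pos hr, half_lt_self hr⟩
  have hcutoff {y : E d} (hy : y ∉ Ω \ range p) : (1 - χ y) * f y = f y := by
    rw [χ.zero_of_le_dist (not_le.1 fun h => hy (hrB h)).le, sub_zero, one_mul]
  have hboundary : ∫ y, (1 - χ y) * f y ∂(surfaceMeasure Ω) = 0 := by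
    rw [← hf0]
    exact setIntegral_congr_fun isClosed_frontier.measurableSet fun y hy =>
      hcutoff fun h => (hΩ.frontier_eq ▸ hy).2 h.1
  calc u x = ∫ y in Ω, u y * poleKernel f χ y :=
        hf.eq_setIntegral_mul_poleKernel hΩ hB sdiff_subset hrB (hu.isWeaklyHarmonicOn hG hΩ)
          (hu.integrable.mono_set sdiff_subset) huc
    _ = ∫ y in Ω, G y (∇ (fun z => (1 - χ z) * f z) y) := by
        rw [hf.integral_apply_gradient_cutoff hΩ hb (hrB.trans sdiff_subset) hu, hu0, mul_zero,
          sub_zero]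
    _ = ∑ i, (1 - χ (p i)) * f (p i) * a i := by
        simp [hG _ (hf.isC1UpToBoundary_cutoff χ), hboundary]
    _ = ∑ i, f (p i) * a i := by
        simp only [fun i => hcutoff fun h : p i ∈ Ω \ range p => h.2 (mem_range_self i)]

theorem HasUnitPole.eq_sum_of_hasPointSources [CompleteSpace F] (hf : HasUnitPole Ω x c f)
    (hx : x ∈ Ω) (hf0 : ∫ y, f y ∂(surfaceMeasure Ω) = 0) (hΩ : IsOpen Ω)
    (hb : Bornology.IsBounded Ω) {u : E d → F} {G : E d → E d →L[ℝ] F} {a : ι → F} {b : F}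
    (hu : HasW11Grad Ω u G) (hG : HasPointSources Ω G p a b)
    (huc : ContinuousOn u (Ω \ range p)) (hu0 : ∫ y, u y ∂(surfaceMeasure Ω) = 0)
    (hxp : x ∉ range p) : u x = ∑ i, f (p i) • a i := by
  refine (SeparatingDual.eq_iff_forall_dual_eq (R := ℝ)).2 fun L => ?_
  simp only [map_sum, map_smul, smul_eq_mul]
  exact hf.eq_sum_mul_of_hasPointSources hx hf0 hΩ hb (hu.clm_comp hΩ L)
    (hu.hasPointSources_clm_comp hG hΩ hb L) (L.continuous.comp_continuousOn huc)
    (by rw [L.integral_comp_comm hu.integrable_trace, hu0, map_zero]) hxp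

end GreenRepresentation

theorem IsNeumannFunction.symm {N : E d → E d → ℝ} (hN : IsNeumannFunction Ω N) (hΩ : IsOpen Ω)
    (hb : Bornology.IsBounded Ω) {x y : E d} (hx : x ∈ closure Ω) (hy : y ∈ closure Ω)
    (hxy : x ≠ y) : N x y = N y x := by
  have hinterior : EqOn (fun q : E d × E d => N q.1 q.2) (fun q => N q.2 q.1)
      ({q | q.1 ≠ q.2} ∩ Ω ×ˢ Ω) := by
    rintro ⟨z, w⟩ ⟨hzw, hz, hw⟩
    have hpole := hN.hasUnitPole hz
    simpa using (hN.hasUnitPole hw).eq_sum_of_hasPointSources hw (hN.integral_boundary w hw) hΩ hb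
      hpole.hasW11Grad hpole.hasPointSources
      (by simpa using hpole.isC1.1.mono (sdiff_subset_sdiff_left subset_closure))
      (hN.integral_boundary z hz) (by simpa using hzw.symm)
  have hopen : IsOpen {q : E d × E d | q.1 ≠ q.2} := isOpen_ne_fun continuous_fst continuous_snd
  refine hinterior.of_subset_closure hN.continuousOn
    (hN.continuousOn.comp continuous_swap.continuousOn fun q hq => ⟨hq.2.1, hq.1, hq.2.2.symm⟩)
    (fun q hq => ⟨subset_closure hq.2.1, subset_closure hq.2.2, hq.1⟩) (fun q hq => ?_)
    (show (x, y) ∈ _ from ⟨hx, hy, hxy⟩)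
  refine hopen.inter_closure ⟨hq.2.2, ?_⟩
  rw [closure_prod_eq]
  exact ⟨hq.1, hq.2.1⟩

namespace IsPointElectrodeSolution

variable {N : E d → E d → ℝ} {γ : E d → ℂ} {γ₀ : ℂ} {I : ℝ} {pp pm q : E d} {u : E d → ℂ}

lemma mul_eq_of_mem (hu : IsPointElectrodeSolution Ω γ I pp pm u) (hN : IsNeumannFunction Ω N)
    (hγ : ∀ y ∈ Ω, γ y = γ₀) (hΩ : IsOpen Ω) (hb : Bornology.IsBounded Ω) (hq : q ∈ Ω)
    (hqp : q ∉ ({pp, pm} : Set (E d))) : γ₀ * u q = I * (N q pp - N q pm) := by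
  obtain ⟨hcont, ⟨G, hG, -, hweak⟩, hmean⟩ := hu
  let L := ContinuousLinearMap.mul ℝ ℂ γ₀
  have hsources : HasPointSources Ω (fun y => L.comp (G y)) ![pp, pm] ![(I : ℂ), -I] 0 := by
    intro φ hφ
    have hcongr : EqOn (fun y => γ y * gradDot (G y) (fderiv ℝ φ y))
        (fun y => L.comp (G y) (∇ φ y)) Ω := fun y hy => by simp [L, hγ y hy, gradDot_fderiv]
    rw [← setIntegral_congr_fun hΩ.measurableSet hcongr, hweak φ hφ]
    simp only [Complex.real_smul, Fin.sum_univ_two, Matrix.cons_val_zero, Matrix.cons_val_one,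
      smul_zero, sub_zero]
    ring
  have hrange : range ![pp, pm] = {pp, pm} := by simp [pair_comm]
  have hgreen := (hN.hasUnitPole hq).eq_sum_of_hasPointSources hq (hN.integral_boundary q hq)
    hΩ hb (hG.clm_comp hΩ L) hsources (L.continuous.comp_continuousOn
      (hcont.mono (hrange ▸ sdiff_subset_sdiff_left subset_closure)))
    (by simp [L, integral_const_mul, hmean]) (hrange ▸ hqp)
  calc γ₀ * u q = N q pp • (I : ℂ) + N q pm • -(I : ℂ) := by simpa [L] using hgreen
    _ = I * (N q pp - N q pm) := by
      simp only [Complex.real_smul]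
      ring

theorem mul_eq (hu : IsPointElectrodeSolution Ω γ I pp pm u) (hN : IsNeumannFunction Ω N)
    (hγ : ∀ y ∈ Ω, γ y = γ₀) (hΩ : IsOpen Ω) (hb : Bornology.IsBounded Ω) (hpp : pp ∈ closure Ω)
    (hpm : pm ∈ closure Ω) (hq : q ∈ closure Ω) (hqp : q ∉ ({pp, pm} : Set (E d))) :
    γ₀ * u q = I * (N pp q - N pm q) := by
  have hinterior : EqOn (fun z => γ₀ * u z) (fun z => I * (N z pp - N z pm)) (Ω \ {pp, pm}) :=
    fun z hz => hu.mul_eq_of_mem hN hγ hΩ hb hz.1 hz.2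
  have hNc {p : E d} (hp : p ∈ closure Ω) (hpe : p ∈ ({pp, pm} : Set (E d))) :
      ContinuousOn (fun z => (N z p : ℂ)) (closure Ω \ {pp, pm}) :=
    Complex.continuous_ofReal.comp_continuousOn (hN.continuousOn.comp
      (continuousOn_id.prodMk continuousOn_const)
      fun z hz => ⟨hz.1, hp, fun h : z = p => hz.2 (h ▸ hpe)⟩)
  have hqpp : q ≠ pp := fun h => hqp (.inl h)
  have hqpm : q ≠ pm := fun h => hqp (.inr h)
  have hopen : IsOpen ({pp, pm}ᶜ : Set (E d)) := (toFinite {pp, pm}).isClosed.isOpen_compl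
  rw [hN.symm hΩ hb hpp hq hqpp.symm, hN.symm hΩ hb hpm hq hqpm.symm]
  exact hinterior.of_subset_closure (continuousOn_const.mul hu.continuousOn)
    (continuousOn_const.mul ((hNc hpp (.inl rfl)).sub (hNc hpm (.inr rfl))))
    (sdiff_subset_sdiff_left subset_closure) hopen.closure_inter ⟨hq, hqp⟩

end IsPointElectrodeSolution

end EIT

theorem lemma2p1_general {d : ℕ} {Ω : Set (EIT.E d)} (hΩ : IsOpen Ω)
    (hb : Bornology.IsBounded Ω) {N₁ : EIT.E d → EIT.E d → ℝ} (hN : EIT.IsNeumannFunction Ω N₁)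
    {γ : EIT.E d → ℂ} {γ₀ : ℂ} (hγ : ∀ x ∈ Ω, γ x = γ₀) {I : ℝ} {pkp pkm plp plm : EIT.E d}
    (hkp : pkp ∈ closure Ω) (hkm : pkm ∈ closure Ω) (hlp : plp ∈ closure Ω)
    (hlm : plm ∈ closure Ω) (hlpk : plp ∉ ({pkp, pkm} : Set (EIT.E d)))
    (hlmk : plm ∉ ({pkp, pkm} : Set (EIT.E d))) {u : EIT.E d → ℂ}
    (hu : EIT.IsPointElectrodeSolution Ω γ I pkp pkm u) :
    γ₀ * EIT.voltage u plp plm =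
      I * (N₁ pkp plp - N₁ pkp plm - N₁ pkm plp + N₁ pkm plm) := by
  rw [EIT.voltage, mul_sub, hu.mul_eq hN hγ hΩ hb hkp hkm hlp hlpk,
    hu.mul_eq hN hγ hΩ hb hkp hkm hlm hlmk]
  ring

theorem lemma2p1 {d : ℕ} (hd : d = 2 ∨ d = 3) (Ω : Set (EIT.E d)) (hΩ : EIT.IsC1Domain Ω)
    (N₁ : EIT.E d → EIT.E d → ℝ) (hN : EIT.IsNeumannFunction Ω N₁)
    (γ : EIT.E d → ℂ) (γ₀ : ℂ) (hγ : ∀ x ∈ Ω, γ x = γ₀) (I : ℝ)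
    (pkp pkm plp plm : EIT.E d)
    (hkp : pkp ∈ frontier Ω) (hkm : pkm ∈ frontier Ω)
    (hlp : plp ∈ frontier Ω) (hlm : plm ∈ frontier Ω)
    (hlpkp : plp ≠ pkp) (hlpkm : plp ≠ pkm) (hlmkp : plm ≠ pkp) (hlmkm : plm ≠ pkm)
    (u : EIT.E d → ℂ) (hu : EIT.IsPointElectrodeSolution Ω γ I pkp pkm u)
    (hU : EIT.voltage u plp plm ≠ 0) :
    γ₀ = (I : ℂ) / EIT.voltage u plp plm *
      ((N₁ pkp plp : ℂ) - (N₁ pkp plm : ℂ) - (N₁ pkm plp : ℂ) + (N₁ pkm plm : ℂ)) := by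
  rw [div_mul_eq_mul_div, eq_div_iff hU]
  exact lemma2p1_general hΩ.isOpen hΩ.isBounded hN hγ (frontier_subset_closure hkp)
    (frontier_subset_closure hkm) (frontier_subset_closure hlp) (frontier_subset_closure hlm)
    (by simp [hlpkp, hlpkm]) (by simp [hlmkp, hlmkm]) hu
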